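/- Let $(\Omega,\mathcal F,\mathbb P)$ be a probability space. A Lévy process $X=(X_t)_{t\in[0,1]}$ is a real-valued process with $X_0=0$, independent and stationary increments, stochastic continuity and càdlàg paths (almost surely). For $\sigma^2\ge 0$, $b\in\mathbb R$ and a measure $\nu$ on $\mathbb R\setminus\{0\}$ with $\int (1\wedge x^2)\,\nu(dx)<\infty$, it is a $(\nu,\sigma^2,b)$-Lévy process if $\mathbb E e^{ivX_t}=e^{-t\psi(v)}$ for all $t\in[0,1]$, $v\in\mathbb R$, where $$\psi(v)=\tfrac{\sigma^2}{2}v^2-ibv+\int_{\mathbb R\setminus\{0\}}\bigl(1-e^{ivx}+\mathbf 1_{\{|x|\le 1\}}ivx\bigr)\,\nu(dx).$$ If $\mu$ is a measure on $\mathbb R\setminus\{0\}$ with $\int(|x|\wedge x^2)\,\mu(dx)<\infty$, a Lévy process is called a $(\mu,\sigma^2)$-Lévy martingale if its characteristic function has the form $\mathbb E e^{ivX_t}=e^{-t\psi(v)}$ for all $t\in[0,1]$, $v\in\mathbb R$, with $\psi(v)=\frac{\sigma^2}{2}v^2+\int_{\mathbb R\setminus\{0\}}(1-e^{ivx}+ivx)\,\mu(dx)$.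 Write $\|X\|=\sup_{t\in[0,1]}|X_t|$. **Proposition 1.3.** Let $X$ be a $(\nu,\sigma^2,b)$-Lévy process under $\mathbb P$ whose Lévy measure $\nu$ has support in $\{|x|\le 1\}$, put $$\Lambda(v):=\tfrac12\sigma^2v^2+bv+\int\bigl[e^{vx}-1-vx\bigr]\,\nu(dx),\qquad v\in\mathbb R,$$ and assume that $u^*\in\mathbb R$ is a solution of $\Lambda'(u^*)=0$. Then $\Lambda$ is the logarithmic moment generating function of $X_1$, i.e. $e^{vX_1}$ is integrable and $\log\mathbb E e^{vX_1}=\Lambda(v)$ for all $v\in\mathbb R$. Moreover, the Esscher transform $\mathbb Q$ on $(\Omega,\mathcal F)$ given by $$\frac{d\mathbb Q}{d\mathbb P}=e^{u^*X_1-\Lambda(u^*)}$$ is a probability measure such that, for all $\varepsilon>0$, $$e^{\Lambda(u^*)-\varepsilon|u^*|}\,\mathbb Q(\|X\|\le\varepsilon)\;\le\;\mathbb P(\|X\|\le\varepsilon)\;\le\; e^{\Lambda(u^*)+\varepsilon|u^*|}\,\mathbb Q(\|X\|\le\varepsilon),$$ and, under $\mathbb Q$, $X$ is an $(e^{u^*x}\,\nu(dx),\sigma^2)$-Lévy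 martingale. -/

import Mathlib

open MeasureTheory ProbabilityTheory Filter Topology
open scoped NNReal ENNReal unitInterval

noncomputable section

/-- `X = (X_t)_{t ∈ [0,1]}` is a real-valued Lévy process under `P`: it starts at `0`, has
independent and stationary increments, is stochastically continuous, and its paths are
almost surely càdlàg. -/
structure IsLevyProcess {Ω : Type*} [MeasurableSpace Ω] (X : I → Ω → ℝ) (P : Measure Ω) :
    Prop where
  measurable : ∀ t, Measurable (X t)
  zero : ∀ᵐ ω ∂P, X 0 ω = 0
  indepIncrements : HasIndepIncrements X P
  stationaryIncrements : ∀ s t s' t' : I, s ≤ t → s' ≤ t' → (t : ℝ) - s = (t' : ℝ) - s' →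
    IdentDistrib (fun ω => X t ω - X s ω) (fun ω => X t' ω - X s' ω) P P
  stochasticContinuity : ∀ t, TendstoInMeasure P X (𝓝 t) (X t)
  cadlag : ∀ᵐ ω ∂P, ∀ t, ContinuousWithinAt (fun s => X s ω) (Set.Ici t) t ∧
    ∃ l, Tendsto (fun s => X s ω) (𝓝[<] t) (𝓝 l)

/-- `ν` is a Lévy measure. A measure on `ℝ \ {0}` is represented as a measure on `ℝ` that does
not charge `0`. -/
structure IsLevyMeasure (ν : Measure ℝ) : Prop where
  zero : ν {0} = 0
  lintegral_lt_top : ∫⁻ x, ENNReal.ofReal (min 1 (x ^ 2)) ∂ν < ∞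

/-- The exponent
`ψ(u) = σ² u² / 2 - i b u + ∫ (1 - e^{iux} + 1_{|x| ≤ 1} i u x) ν(dx)`. -/
def levyKhintchineExponent (ν : Measure ℝ) (σsq : ℝ≥0) (b u : ℝ) : ℂ :=
  (σsq : ℂ) / 2 * u ^ 2 - Complex.I * b * u +
    ∫ x : ℝ, (1 - Complex.exp (Complex.I * u * x) +
      if |x| ≤ 1 then Complex.I * u * x else 0) ∂ν

/-- `X` is a `(ν, σ², b)`-Lévy process under `P`: it is a Lévy process, `ν` is a Lévy measure,
and `E e^{iuX_t} = e^{-tψ(u)}`. -/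
structure IsLevyProcessWithTriplet {Ω : Type*} [MeasurableSpace Ω] (X : I → Ω → ℝ)
    (P : Measure Ω) (ν : Measure ℝ) (σsq : ℝ≥0) (b : ℝ) : Prop where
  isLevyProcess : IsLevyProcess X P
  isLevyMeasure : IsLevyMeasure ν
  charFun_eq : ∀ (t : I) (u : ℝ), ∫ ω, Complex.exp (Complex.I * u * X t ω) ∂P =
    Complex.exp (-((t : ℝ) : ℂ) * levyKhintchineExponent ν σsq b u)

/-- The fully compensated exponent `ψ(u) = σ² u² / 2 + ∫ (1 - e^{iux} + i u x) ν(dx)`. -/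
def levyMartingaleExponent (ν : Measure ℝ) (σsq : ℝ≥0) (u : ℝ) : ℂ :=
  (σsq : ℂ) / 2 * u ^ 2 +
    ∫ x : ℝ, (1 - Complex.exp (Complex.I * u * x) + Complex.I * u * x) ∂ν

/-- `X` is a `(ν, σ²)`-Lévy martingale under `P`: it is a Lévy process, `ν` is a measure on
`ℝ \ {0}` with `∫ |x| ∧ x² ν(dx) < ∞`, and `E e^{iuX_t} = e^{-tψ(u)}` with the fully compensated
exponent `ψ`. -/
structure IsLevyMartingale {Ω : Type*} [MeasurableSpace Ω] (X : I → Ω → ℝ)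
    (P : Measure Ω) (ν : Measure ℝ) (σsq : ℝ≥0) : Prop where
  isLevyProcess : IsLevyProcess X P
  zero : ν {0} = 0
  lintegral_lt_top : ∫⁻ x, ENNReal.ofReal (min |x| (x ^ 2)) ∂ν < ∞
  charFun_eq : ∀ (t : I) (u : ℝ), ∫ ω, Complex.exp (Complex.I * u * X t ω) ∂P =
    Complex.exp (-((t : ℝ) : ℂ) * levyMartingaleExponent ν σsq u)

/-- `Λ(u) = σ² u² / 2 + b u + ∫ (e^{ux} - 1 - ux) ν(dx)`. -/
def levyLambda (ν : Measure ℝ) (σsq : ℝ≥0) (b u : ℝ) : ℝ :=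
  (σsq : ℝ) / 2 * u ^ 2 + b * u + ∫ x : ℝ, (Real.exp (u * x) - 1 - u * x) ∂ν

/-- The Esscher transform `Q`, given by `dQ/dP = e^{u X_1 - Λ(u)}`. -/
def esscherTransform {Ω : Type*} [MeasurableSpace Ω] (X : I → Ω → ℝ) (P : Measure Ω)
    (ν : Measure ℝ) (σsq : ℝ≥0) (b u : ℝ) : Measure Ω :=
  P.withDensity fun ω => ENNReal.ofReal (Real.exp (u * X 1 ω - levyLambda ν σsq b u))

/-- The measure `e^{ux} ν(dx)`. -/
def expTilt (ν : Measure ℝ) (u : ℝ) : Measure ℝ :=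
  ν.withDensity fun x => ENNReal.ofReal (Real.exp (u * x))

/-- The supremum norm `‖X‖ = sup_{t ∈ [0,1]} |X_t|` of the path, with values in `[0, ∞]`. -/
def pathSupNorm {Ω : Type*} (X : I → Ω → ℝ) (ω : Ω) : ℝ≥0∞ :=
  ⨆ t : I, ENNReal.ofReal |X t ω|

end

/-!
By the Lévy–Khintchine formula the characteristic function of `X_t` is the restriction to the
imaginary axis of `z ↦ e^{tΛ(z)}`. Since `ν` lives on `[-1, 1]` and integrates `x²`, the function
`Λ` extends to an entire function, `complexLevyLambda`. A finite measure whose characteristic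
function has an entire extension `G` has exponential moments of all orders
(`integrable_exp_of_charFun_eq`): Fatou's lemma on second differences shows that `x²` is
integrable, `x² μ(dx)` again has an entire extension of its characteristic function, namely `G''`,
and so `∫ x^{2k} dμ ≤ |G^{(2k)}(0)|` for all `k`; Cauchy's estimates make the series of
`∫ cosh (vx) dμ` converge. The identity theorem then gives `∫ e^{zx} dμ = G(z)` for all complex `z`
(`complexMGF_eq_of_charFun_eq`), so that `E e^{zX_t} = e^{tΛ(z)}`.

For the Esscher transform `Q`, the density `e^{uX_1 - Λ(u)}` factorizes over the increments along
any partition of `[0, 1]`, each factor having expectation one. A density of product form preserves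
independence (`iIndepFun_withDensity_prod`) and tilts each marginal separately, so the increments
remain independent and stationary under `Q`. The characteristic function of `X_t` under `Q` at `v`
is `exp (t (Λ(u + iv) - Λ(u)))`, and the exponent differs from the fully compensated one of
`e^{ux} ν(dx)` by `i v Λ'(u) = 0` (`complexLevyLambda_add_mul_I_sub`). The two-sided bound holds
because `|X_1| ≤ ε` on `{‖X‖ ≤ ε}`, which bounds the density from both sides.
-/

/-! ### Finite measures whose characteristic function extends to an entire function -/

theorem isBigO_symmetric_second_difference {G : ℂ → ℂ} (hG : Differentiable ℂ G) :
    (fun z => G z + G (-z) - 2 * G 0) =O[𝓝 0] fun z => z ^ 2 := by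
  set S : ℂ → ℂ := fun z => G z + G (-z) - 2 * G 0 with hS
  have hSd : Differentiable ℂ S := by fun_prop
  have hS0 : S 0 = 0 := by simp [hS]; ring
  have hS' : deriv S 0 = 0 := by
    have h1 : HasDerivAt G (deriv G 0) (-0) := by simpa using (hG 0).hasDerivAt
    have h2 : HasDerivAt S (deriv G 0 + deriv G 0 * (-1)) 0 :=
      ((hG 0).hasDerivAt.add (h1.comp (0 : ℂ) (hasDerivAt_neg (0 : ℂ)))).sub_const _
    simpa using h2.deriv
  have hT : DifferentiableAt ℂ (dslope S 0) 0 :=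
    ((Complex.differentiableOn_dslope univ_mem).2 hSd.differentiableOn).differentiableAt univ_mem
  have hO : (dslope S 0) =O[𝓝 0] fun z : ℂ => z := by
    simpa [dslope_same, hS'] using hT.isBigO_sub
  have := (Asymptotics.isBigO_refl (fun z : ℂ => z) (𝓝 0)).mul hO
  refine (this.congr (fun z => ?_) (fun z => by ring))
  have h := sub_smul_dslope S 0 z
  simpa [hS0] using h

/-- Fatou's lemma, applied to the symmetric second difference quotients of the characteristic
function at `0`. -/
theorem integrable_sq_of_charFun_eq {μ : Measure ℝ} [IsFiniteMeasure μ] {G : ℂ → ℂ}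
    (hG : Differentiable ℂ G) (h : ∀ t : ℝ, charFun μ t = G (t * Complex.I)) :
    Integrable (fun x : ℝ => x ^ 2) μ := by
  set q : ℝ → ℝ → ℝ := fun t x => (t⁻¹ * (2 * Real.sin (t * x / 2))) ^ 2 with hq
  have hlim : ∀ x, Tendsto (fun t => ENNReal.ofReal (q t x)) (𝓝[≠] 0)
      (𝓝 (ENNReal.ofReal (x ^ 2))) := by
    intro x
    refine ENNReal.tendsto_ofReal (Tendsto.pow ?_ 2)
    have hd : HasDerivAt (fun t : ℝ => 2 * Real.sin (t * x / 2)) x 0 := by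
      have h1 : HasDerivAt (fun t : ℝ => t * x / 2) (1 * x / 2) 0 :=
        ((hasDerivAt_id (0 : ℝ)).mul_const x).div_const 2
      refine (h1.sin.const_mul 2).congr_deriv ?_
      simp
      ring
    simpa using hd.tendsto_slope_zero
  have hqint : ∀ t, Integrable (q t) μ := by
    intro t
    refine Integrable.of_bound (C := (|t⁻¹| * 2) ^ 2) (by fun_prop) (ae_of_all _ fun x => ?_)
    rw [hq, Real.norm_eq_abs, abs_pow, abs_mul, abs_mul, abs_two]
    gcongr
    nlinarith [Real.abs_sin_le_one (t * x / 2)]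
  -- The second difference of `t ↦ e^{itx}` at `0` is `2 cos (tx) - 2 = -(2 sin (tx / 2))²`.
  have hval : ∀ t : ℝ, ((∫ x, q t x ∂μ : ℝ) : ℂ) =
      -(t⁻¹ : ℂ) ^ 2 * (G (t * Complex.I) + G (-(t * Complex.I)) - 2 * G 0) := by
    intro t
    have hb : ∀ s : ℝ, Integrable (fun x : ℝ => Complex.exp (s * x * Complex.I)) μ := by
      intro s
      refine Integrable.of_bound (C := 1) (by fun_prop) (ae_of_all _ fun x => ?_)
      rw [← Complex.ofReal_mul, Complex.norm_exp_ofReal_mul_I]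
    have e1 := h t
    have e2 := h (-t)
    have e3 := h 0
    rw [charFun_apply_real] at e1 e2 e3
    have e2' : G (-(t * Complex.I)) = ∫ x : ℝ, Complex.exp (((-t : ℝ) : ℂ) * x * Complex.I) ∂μ := by
      rw [e2]; congr 1; push_cast; ring
    have e3' : G 0 = ∫ x : ℝ, Complex.exp (((0 : ℝ) : ℂ) * x * Complex.I) ∂μ := by
      rw [e3]; congr 1; push_cast; ring
    have hadd : Integrable (fun x : ℝ => Complex.exp (t * x * Complex.I) +
        Complex.exp (((-t : ℝ) : ℂ) * x * Complex.I)) μ := (hb t).add (hb (-t))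
    rw [← e1, e2', e3', ← integral_add (hb _) (hb _), ← integral_const_mul,
      ← integral_sub hadd ((hb _).const_mul _), ← integral_const_mul,
      ← integral_complex_ofReal]
    refine integral_congr_ae (ae_of_all _ fun x => ?_)
    have hc : Complex.exp (((-t : ℝ) : ℂ) * x * Complex.I) =
      Complex.exp (-((t : ℂ) * x) * Complex.I) := by congr 1; push_cast; ring
    have hcos := Complex.two_cos (t * x)
    have hsin : 2 * Complex.cos (t * x) = 2 - 4 * Complex.sin (t * x / 2) ^ 2 := by
      have h1 : (t : ℂ) * x = 2 * (t * x / 2) := by ring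
      rw [h1, Complex.cos_two_mul, Complex.cos_sq']
      ring_nf
    simp only [hq, hc]
    push_cast
    simp only [zero_mul, Complex.exp_zero]
    linear_combination (-(t⁻¹ : ℂ) ^ 2) * (hcos - hsin)
  obtain ⟨C, hC⟩ := (isBigO_symmetric_second_difference hG).bound
  have hbound : ∀ᶠ t : ℝ in 𝓝[≠] 0, ∫⁻ x, ENNReal.ofReal (q t x) ∂μ ≤ ENNReal.ofReal C := by
    have ht : Tendsto (fun t : ℝ => (t : ℂ) * Complex.I) (𝓝[≠] 0) (𝓝 0) := by
      have : Continuous (fun t : ℝ => (t : ℂ) * Complex.I) := by fun_prop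
      simpa using (this.tendsto 0).mono_left nhdsWithin_le_nhds
    filter_upwards [ht.eventually hC, self_mem_nhdsWithin] with t h1 h0
    rw [← ofReal_integral_eq_lintegral_ofReal (hqint t) (ae_of_all _ fun x => by positivity)]
    refine ENNReal.ofReal_le_ofReal ((le_abs_self _).trans ?_)
    rw [← Real.norm_eq_abs, ← Complex.norm_real, hval t, norm_mul]
    have h0' : (0 : ℝ) < |t| := abs_pos.2 h0
    calc _ ≤ ‖-(t⁻¹ : ℂ) ^ 2‖ * (C * ‖((t : ℂ) * Complex.I) ^ 2‖) := by gcongr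
      _ = C := by
        simp only [norm_neg, norm_pow, norm_inv, Complex.norm_real, Real.norm_eq_abs, norm_mul,
          Complex.norm_I, mul_one]
        field_simp
  have hfin : ∫⁻ x, ENNReal.ofReal (x ^ 2) ∂μ ≤ ENNReal.ofReal C :=
    calc ∫⁻ x, ENNReal.ofReal (x ^ 2) ∂μ
        = ∫⁻ x, liminf (fun t => ENNReal.ofReal (q t x)) (𝓝[≠] 0) ∂μ :=
          lintegral_congr fun x => (hlim x).liminf_eq.symm
      _ ≤ liminf (fun t => ∫⁻ x, ENNReal.ofReal (q t x) ∂μ) (𝓝[≠] 0) :=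
          lintegral_liminf_le fun t => by fun_prop
      _ ≤ liminf (fun _ => ENNReal.ofReal C) (𝓝[≠] (0 : ℝ)) := liminf_le_liminf hbound
      _ = ENNReal.ofReal C := liminf_const _
  refine ⟨by fun_prop, ?_⟩
  rw [hasFiniteIntegral_iff_ofReal (ae_of_all _ fun x => by positivity)]
  exact hfin.trans_lt ENNReal.ofReal_lt_top

theorem iteratedDeriv_two_comp_mul_I {G : ℂ → ℂ} (hG : Differentiable ℂ G) (t : ℝ) :
    iteratedDeriv 2 (fun s : ℝ => G (s * Complex.I)) t =
      Complex.I ^ 2 * deriv (deriv G) (t * Complex.I) := by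
  have key : ∀ {F : ℂ → ℂ}, Differentiable ℂ F → ∀ s : ℝ,
      HasDerivAt (fun s : ℝ => F (s * Complex.I)) (deriv F (s * Complex.I) * Complex.I) s := by
    intro F hF s
    have h1 : HasDerivAt (fun z : ℂ => z * Complex.I) (1 * Complex.I) (s : ℂ) :=
      (hasDerivAt_id _).mul_const _
    simpa using ((hF _).hasDerivAt.comp (s : ℂ) h1).comp_ofReal
  rw [iteratedDeriv_succ, iteratedDeriv_one, funext fun s => (key hG s).deriv,
    ((key hG.deriv t).mul_const _).deriv]
  ring

/-- The measure `x² μ(dx)` has characteristic function `G''(it)`. -/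
theorem charFun_withDensity_sq {μ : Measure ℝ} [IsFiniteMeasure μ] {G : ℂ → ℂ}
    (hG : Differentiable ℂ G) (h : ∀ t : ℝ, charFun μ t = G (t * Complex.I)) (t : ℝ) :
    charFun (μ.withDensity fun x => ENNReal.ofReal (x ^ 2)) t =
      deriv (deriv G) (t * Complex.I) := by
  have hsq := integrable_sq_of_charFun_eq hG h
  have hmem : MemLp id ((2 : ℕ) : ℝ≥0∞) μ := by
    simpa using (memLp_two_iff_integrable_sq (f := (id : ℝ → ℝ)) (by fun_prop)).2 hsq
  have h1 := iteratedDeriv_charFun hmem (t := t)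
  rw [funext h, iteratedDeriv_two_comp_mul_I hG] at h1
  rw [mul_left_cancel₀ (by simp) h1, charFun_apply_real,
    integral_withDensity_eq_integral_toReal_smul (by fun_prop) (by simp)]
  refine integral_congr_ae (ae_of_all _ fun x => ?_)
  simp [ENNReal.toReal_ofReal (sq_nonneg x)]

/-- By induction on `k`, replacing `μ` by `x² μ(dx)` and `G` by `G''` in each step. -/
theorem lintegral_pow_even_le {G : ℂ → ℂ} (k : ℕ) {μ : Measure ℝ} [IsFiniteMeasure μ]
    (hG : Differentiable ℂ G) (h : ∀ t : ℝ, charFun μ t = G (t * Complex.I)) :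
    ∫⁻ x, ENNReal.ofReal (x ^ (2 * k)) ∂μ ≤ ENNReal.ofReal ‖iteratedDeriv (2 * k) G 0‖ := by
  induction k generalizing G μ with
  | zero =>
    have h0 := h 0
    simp only [charFun_zero, Complex.ofReal_zero, zero_mul] at h0
    simp only [mul_zero, pow_zero, ENNReal.ofReal_one, lintegral_one, iteratedDeriv_zero, ← h0,
      Complex.norm_real, Real.norm_eq_abs, abs_of_nonneg measureReal_nonneg]
    simp
  | succ k ih =>
    have hsq := integrable_sq_of_charFun_eq hG h
    have : IsFiniteMeasure (μ.withDensity fun x => ENNReal.ofReal (x ^ 2)) :=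
      isFiniteMeasure_withDensity_ofReal hsq.2
    have := ih hG.deriv.deriv (charFun_withDensity_sq hG h)
    rw [lintegral_withDensity_eq_lintegral_mul _ (by fun_prop) (by fun_prop)] at this
    rw [mul_add, mul_one, iteratedDeriv_succ', iteratedDeriv_succ']
    refine le_trans (le_of_eq (lintegral_congr fun x => ?_)) this
    rw [Pi.mul_apply, ← ENNReal.ofReal_mul (by positivity)]
    ring_nf

/-- The even moments of `μ` are at most `|G⁽²ᵏ⁾(0)|`, which Cauchy's estimates bound by
`C (2k)! / R²ᵏ` for every radius `R`; hence `cosh (vx)` is integrable. -/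
theorem integrable_cosh_of_charFun_eq {μ : Measure ℝ} [IsFiniteMeasure μ] {G : ℂ → ℂ}
    (hG : Differentiable ℂ G) (h : ∀ t : ℝ, charFun μ t = G (t * Complex.I)) (v : ℝ) :
    Integrable (fun x => Real.cosh (v * x)) μ := by
  -- Any radius larger than `|v|` makes the series below geometric with ratio less than one.
  set R : ℝ := |v| + 1 with hR
  have hRpos : 0 < R := by positivity
  obtain ⟨C, hC⟩ := (isCompact_sphere (0 : ℂ) R).exists_bound_of_continuousOn
    hG.continuous.continuousOn
  have hcauchy : ∀ n, ‖iteratedDeriv n G 0‖ ≤ n.factorial * C / R ^ n := fun n =>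
    Complex.norm_iteratedDeriv_le_of_forall_mem_sphere_norm_le n hRpos hG.diffContOnCl hC
  set r : ℝ := (v / R) ^ 2 with hr
  have hr1 : r < 1 := by
    rw [hr, sq_lt_one_iff_abs_lt_one, abs_div, abs_of_pos hRpos, div_lt_one hRpos, hR]
    linarith
  have hcosh : ∀ x : ℝ, ENNReal.ofReal (Real.cosh (v * x)) =
      ∑' k : ℕ, ENNReal.ofReal ((v * x) ^ (2 * k) / (2 * k).factorial) := by
    intro x
    rw [← (Real.hasSum_cosh (v * x)).tsum_eq, ENNReal.ofReal_tsum_of_nonneg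
      (fun k => div_nonneg (Even.pow_nonneg (even_two_mul k) _) (by positivity))
      (Real.hasSum_cosh (v * x)).summable]
  have hterm : ∀ k : ℕ, ∫⁻ x, ENNReal.ofReal ((v * x) ^ (2 * k) / (2 * k).factorial) ∂μ ≤
      ENNReal.ofReal (C * r ^ k) := by
    intro k
    have hv : 0 ≤ v ^ (2 * k) := Even.pow_nonneg (even_two_mul k) _
    calc ∫⁻ x, ENNReal.ofReal ((v * x) ^ (2 * k) / (2 * k).factorial) ∂μ
        = ENNReal.ofReal (v ^ (2 * k) / (2 * k).factorial) *
            ∫⁻ x, ENNReal.ofReal (x ^ (2 * k)) ∂μ := by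
          rw [← lintegral_const_mul _ (by fun_prop)]
          refine lintegral_congr fun x => ?_
          rw [← ENNReal.ofReal_mul (by positivity)]
          ring_nf
      _ ≤ ENNReal.ofReal (v ^ (2 * k) / (2 * k).factorial) *
            ENNReal.ofReal ((2 * k).factorial * C / R ^ (2 * k)) := by
          gcongr
          exact (lintegral_pow_even_le k hG h).trans (ENNReal.ofReal_le_ofReal (hcauchy _))
      _ = ENNReal.ofReal (C * r ^ k) := by
          rw [← ENNReal.ofReal_mul (by positivity), hr, ← pow_mul, div_pow]
          congr 1
          have : ((2 * k).factorial : ℝ) ≠ 0 := by positivity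
          field_simp
  have hC0 : 0 ≤ C := by
    obtain ⟨z, hz⟩ := (NormedSpace.sphere_nonempty (x := (0 : ℂ)) (r := R)).2 hRpos.le
    exact (norm_nonneg _).trans (hC z hz)
  refine ⟨by fun_prop, ?_⟩
  rw [hasFiniteIntegral_iff_ofReal (ae_of_all _ fun x => (Real.cosh_pos _).le)]
  rw [lintegral_congr hcosh, lintegral_tsum fun k => by fun_prop]
  have hs : Summable fun k : ℕ => C * r ^ k :=
    (summable_geometric_of_lt_one (by positivity) hr1).mul_left C
  refine (ENNReal.tsum_le_tsum hterm).trans_lt ?_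
  rw [← ENNReal.ofReal_tsum_of_nonneg (fun k => by positivity) hs]
  exact ENNReal.ofReal_lt_top

theorem integrable_exp_of_charFun_eq {μ : Measure ℝ} [IsFiniteMeasure μ] {G : ℂ → ℂ}
    (hG : Differentiable ℂ G) (h : ∀ t : ℝ, charFun μ t = G (t * Complex.I)) (v : ℝ) :
    Integrable (fun x => Real.exp (v * x)) μ := by
  refine ((integrable_cosh_of_charFun_eq hG h v).const_mul 2).mono' (by fun_prop)
    (ae_of_all _ fun x => ?_)
  rw [Real.norm_eq_abs, Real.abs_exp, Real.cosh_eq]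
  linarith [Real.exp_pos (-(v * x))]

/-- The exponential moments are finite, so the complex moment generating function is entire; it
agrees with `G` on the imaginary axis, hence everywhere. -/
theorem complexMGF_eq_of_charFun_eq {μ : Measure ℝ} [IsFiniteMeasure μ] {G : ℂ → ℂ}
    (hG : Differentiable ℂ G) (h : ∀ t : ℝ, charFun μ t = G (t * Complex.I)) :
    complexMGF id μ = G := by
  have huniv : integrableExpSet id μ = Set.univ :=
    Set.eq_univ_of_forall fun v => integrable_exp_of_charFun_eq hG h v
  have hA : AnalyticOnNhd ℂ (complexMGF id μ) Set.univ := by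
    simpa [huniv] using analyticOnNhd_complexMGF (X := id) (μ := μ)
  refine hA.eq_of_frequently_eq (z₀ := 0) (fun z _ => hG.analyticAt z) ?_
  have hreal : ∃ᶠ t : ℝ in 𝓝[≠] 0, complexMGF id μ (t * Complex.I) = G (t * Complex.I) :=
    .of_forall fun t => by rw [complexMGF_id_mul_I, h]
  refine Tendsto.frequently ?_ hreal
  refine tendsto_nhdsWithin_iff.2 ⟨?_, ?_⟩
  · have : Continuous (fun t : ℝ => (t : ℂ) * Complex.I) := by fun_prop
    simpa using (this.tendsto 0).mono_left nhdsWithin_le_nhds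
  · filter_upwards [self_mem_nhdsWithin] with t ht
    simpa using ht

/-! ### The entire extension of the log-moment generating function -/

/-- The extension of `levyLambda` to complex arguments,
`Λ(z) = σ² z² / 2 + b z + ∫ (e^{zx} - 1 - zx) ν(dx)`. -/
noncomputable def complexLevyLambda (ν : Measure ℝ) (σsq : ℝ≥0) (b : ℝ) (z : ℂ) : ℂ :=
  (σsq : ℂ) / 2 * z ^ 2 + b * z + ∫ x : ℝ, (Complex.exp (z * x) - 1 - z * x) ∂ν

theorem norm_cexp_sub_one_le (w : ℂ) : ‖Complex.exp w - 1‖ ≤ ‖w‖ * Real.exp ‖w‖ := by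
  simpa using Complex.norm_exp_sub_sum_le_norm_mul_exp w 1

theorem norm_cexp_sub_one_sub_le (w : ℂ) :
    ‖Complex.exp w - 1 - w‖ ≤ ‖w‖ ^ 2 * Real.exp ‖w‖ := by
  simpa [Finset.sum_range_succ, sub_sub] using Complex.norm_exp_sub_sum_le_norm_mul_exp w 2

theorem ae_abs_le_one_of_support_subset {ν : Measure ℝ} (hν : ν.support ⊆ {x : ℝ | |x| ≤ 1}) :
    ∀ᵐ x ∂ν, |x| ≤ 1 :=
  mem_of_superset Measure.support_mem_ae hν

section

variable {ν : Measure ℝ}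

theorem IsLevyMeasure.integrable_sq (hL : IsLevyMeasure ν) (hν : ∀ᵐ x ∂ν, |x| ≤ 1) :
    Integrable (fun x : ℝ => x ^ 2) ν := by
  refine ⟨by fun_prop, ?_⟩
  rw [hasFiniteIntegral_iff_ofReal (ae_of_all _ fun x => by positivity)]
  refine (le_of_eq (lintegral_congr_ae ?_)).trans_lt hL.lintegral_lt_top
  filter_upwards [hν] with x hx
  rw [min_eq_right ((sq_le_one_iff_abs_le_one x).2 hx)]

theorem IsLevyMeasure.integrable_cexp_sub (hL : IsLevyMeasure ν)
    (hν : ∀ᵐ x ∂ν, |x| ≤ 1) (z : ℂ) :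
    Integrable (fun x : ℝ => Complex.exp (z * x) - 1 - z * x) ν := by
  refine ((hL.integrable_sq hν).const_mul (‖z‖ ^ 2 * Real.exp ‖z‖)).mono' (by fun_prop) ?_
  filter_upwards [hν] with x hx
  refine (norm_cexp_sub_one_sub_le _).trans ?_
  rw [norm_mul, Complex.norm_real, Real.norm_eq_abs, mul_pow, sq_abs]
  have : ‖z‖ * |x| ≤ ‖z‖ := mul_le_of_le_one_right (norm_nonneg _) hx
  calc ‖z‖ ^ 2 * x ^ 2 * Real.exp (‖z‖ * |x|) ≤ ‖z‖ ^ 2 * x ^ 2 * Real.exp ‖z‖ := by gcongr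
    _ = _ := by ring

theorem IsLevyMeasure.integrable_and_hasDerivAt_cexp_sub (hL : IsLevyMeasure ν)
    (hν : ∀ᵐ x ∂ν, |x| ≤ 1) (z : ℂ) :
    Integrable (fun x : ℝ => (x : ℂ) * (Complex.exp (z * x) - 1)) ν ∧
    HasDerivAt (fun w : ℂ => ∫ x : ℝ, (Complex.exp (w * x) - 1 - w * x) ∂ν)
      (∫ x : ℝ, (x : ℂ) * (Complex.exp (z * x) - 1) ∂ν) z := by
  set r : ℝ := ‖z‖ + 1
  refine hasDerivAt_integral_of_dominated_loc_of_deriv_le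
    (F := fun w x => Complex.exp (w * x) - 1 - w * x)
    (F' := fun w x => (x : ℂ) * (Complex.exp (w * x) - 1))
    (bound := fun x => (r * Real.exp r) * x ^ 2) (Metric.ball_mem_nhds z one_pos)
    (.of_forall fun w => by fun_prop) (hL.integrable_cexp_sub hν z) (by fun_prop) ?_
    ((hL.integrable_sq hν).const_mul _) ?_
  · filter_upwards [hν] with x hx w hw
    have hw' : ‖w‖ ≤ r := by
      have := norm_sub_norm_le w z
      rw [Metric.mem_ball, dist_eq_norm] at hw
      linarith
    have h1 : ‖w * x‖ ≤ r * |x| := by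
      rw [norm_mul, Complex.norm_real, Real.norm_eq_abs]
      gcongr
    have h2 : ‖w * x‖ ≤ r := h1.trans (mul_le_of_le_one_right (by positivity) hx)
    rw [norm_mul, Complex.norm_real, Real.norm_eq_abs]
    calc |x| * ‖Complex.exp (w * x) - 1‖ ≤ |x| * (r * |x| * Real.exp r) := by
          gcongr
          exact (norm_cexp_sub_one_le _).trans (by gcongr)
      _ = r * Real.exp r * |x| ^ 2 := by ring
      _ = _ := by rw [sq_abs]
  · refine ae_of_all _ fun x w _ => ?_
    have h1 : HasDerivAt (fun w : ℂ => w * x) (1 * (x : ℂ)) w := (hasDerivAt_id w).mul_const _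
    exact ((h1.cexp.sub_const 1).sub h1).congr_deriv (by ring)

theorem hasDerivAt_complexLevyLambda (hL : IsLevyMeasure ν) (hν : ∀ᵐ x ∂ν, |x| ≤ 1)
    (σsq : ℝ≥0) (b : ℝ) (z : ℂ) :
    HasDerivAt (complexLevyLambda ν σsq b)
      (σsq * z + b + ∫ x : ℝ, (x : ℂ) * (Complex.exp (z * x) - 1) ∂ν) z := by
  have h1 : HasDerivAt (fun w : ℂ => (σsq : ℂ) / 2 * w ^ 2) (σsq * z) z :=
    ((hasDerivAt_pow 2 z).const_mul _).congr_deriv (by norm_num; ring)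
  have h2 : HasDerivAt (fun w : ℂ => (b : ℂ) * w) b z :=
    ((hasDerivAt_id z).const_mul _).congr_deriv (by simp)
  exact (h1.add h2).add (hL.integrable_and_hasDerivAt_cexp_sub hν z).2

theorem differentiable_complexLevyLambda (hL : IsLevyMeasure ν) (hν : ∀ᵐ x ∂ν, |x| ≤ 1)
    (σsq : ℝ≥0) (b : ℝ) :
    Differentiable ℂ (complexLevyLambda ν σsq b) :=
  fun z => (hasDerivAt_complexLevyLambda hL hν σsq b z).differentiableAt

theorem complexLevyLambda_mul_I (hν : ∀ᵐ x ∂ν, |x| ≤ 1) (σsq : ℝ≥0) (b t : ℝ) :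
    complexLevyLambda ν σsq b (t * Complex.I) = -levyKhintchineExponent ν σsq b t := by
  have : ∫ x : ℝ, (Complex.exp (t * Complex.I * x) - 1 - t * Complex.I * x) ∂ν =
      -∫ x : ℝ, (1 - Complex.exp (Complex.I * t * x) +
        if |x| ≤ 1 then Complex.I * t * x else 0) ∂ν := by
    rw [← integral_neg]
    refine integral_congr_ae ?_
    filter_upwards [hν] with x hx
    simp only [hx, if_true, mul_comm Complex.I (t : ℂ)]
    ring
  rw [complexLevyLambda, levyKhintchineExponent, this, mul_pow, Complex.I_sq]
  ring

theorem complexLevyLambda_ofReal (σsq : ℝ≥0) (b v : ℝ) :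
    complexLevyLambda ν σsq b v = levyLambda ν σsq b v := by
  have : ∫ x : ℝ, (Complex.exp ((v : ℂ) * x) - 1 - v * x) ∂ν =
      ((∫ x : ℝ, (Real.exp (v * x) - 1 - v * x) ∂ν : ℝ) : ℂ) := by
    rw [← integral_complex_ofReal]
    refine integral_congr_ae (ae_of_all _ fun x => ?_)
    push_cast
    rfl
  rw [complexLevyLambda, levyLambda, this]
  push_cast
  rfl

/-- The critical point equation `Λ'(u) = 0`, with the derivative computed under the integral. -/
theorem critical_point_equation (hL : IsLevyMeasure ν) (hν : ∀ᵐ x ∂ν, |x| ≤ 1)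
    {σsq : ℝ≥0} {b u : ℝ}
    (hu : HasDerivAt (levyLambda ν σsq b) 0 u) :
    (σsq * u + b + ∫ x : ℝ, (x : ℂ) * (Complex.exp (u * x) - 1) ∂ν : ℂ) = 0 := by
  have h1 := (hasDerivAt_complexLevyLambda hL hν σsq b u).comp_ofReal
  have h2 := hu.ofReal_comp
  simp only [complexLevyLambda_ofReal] at h1
  simpa using h1.unique h2

/-- At a critical point `u` of `Λ` the drift of the tilted exponent vanishes:
`Λ(u + iv) - Λ(u)` is minus the fully compensated exponent of `e^{ux} ν(dx)`, up to the term
`i v Λ'(u) = 0`. -/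
theorem complexLevyLambda_add_mul_I_sub (hL : IsLevyMeasure ν) (hν : ∀ᵐ x ∂ν, |x| ≤ 1)
    {σsq : ℝ≥0} {b u : ℝ}
    (hu : HasDerivAt (levyLambda ν σsq b) 0 u) (v : ℝ) :
    complexLevyLambda ν σsq b (u + v * Complex.I) - complexLevyLambda ν σsq b u =
      -levyMartingaleExponent (expTilt ν u) σsq v := by
  have hcrit := critical_point_equation hL hν hu
  have htilt : ∫ x : ℝ, (1 - Complex.exp (Complex.I * v * x) + Complex.I * v * x) ∂expTilt ν u =
      -(∫ x : ℝ, (Complex.exp ((u + v * Complex.I) * x) - 1 - (u + v * Complex.I) * x) ∂ν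
        - ∫ x : ℝ, (Complex.exp (u * x) - 1 - u * x) ∂ν
        - v * Complex.I * ∫ x : ℝ, (x : ℂ) * (Complex.exp (u * x) - 1) ∂ν) := by
    have i1 := hL.integrable_cexp_sub hν (u + v * Complex.I)
    have i2 := hL.integrable_cexp_sub hν u
    have i3 := (hL.integrable_and_hasDerivAt_cexp_sub hν u).1
    have i12 : Integrable (fun x : ℝ => (Complex.exp ((u + v * Complex.I) * x) - 1 -
        (u + v * Complex.I) * x) - (Complex.exp (u * x) - 1 - u * x)) ν := i1.sub i2
    rw [← integral_const_mul, ← integral_sub i1 i2, ← integral_sub i12 (i3.const_mul _),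
      ← integral_neg, expTilt, integral_withDensity_eq_integral_toReal_smul (by fun_prop) (by simp)]
    refine integral_congr_ae (ae_of_all _ fun x => ?_)
    have he : Complex.exp ((u + v * Complex.I) * x) =
        Complex.exp (u * x) * Complex.exp (Complex.I * v * x) := by
      rw [← Complex.exp_add]; congr 1; ring
    simp only [ENNReal.toReal_ofReal (Real.exp_pos _).le, Complex.real_smul, Complex.ofReal_exp,
      Complex.ofReal_mul, he]
    ring
  rw [levyMartingaleExponent, htilt]
  simp only [complexLevyLambda]
  linear_combination (v * Complex.I) * hcrit + (σsq : ℂ) / 2 * v ^ 2 * Complex.I_sq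

end

section

variable {Ω : Type*} [MeasurableSpace Ω] {P : Measure Ω} {X : I → Ω → ℝ} {ν : Measure ℝ}
  {σsq : ℝ≥0} {b : ℝ}

/-- The characteristic function of `X_t` has the entire extension `e^{tΛ(z)}`. -/
theorem IsLevyProcessWithTriplet.charFun_map [IsProbabilityMeasure P]
    (hX : IsLevyProcessWithTriplet X P ν σsq b) (hν : ∀ᵐ x ∂ν, |x| ≤ 1) (t : I) (s : ℝ) :
    charFun (P.map (X t)) s =
      Complex.exp ((t : ℝ) * complexLevyLambda ν σsq b (s * Complex.I)) := by
  rw [charFun_apply_real, integral_map (hX.isLevyProcess.measurable t).aemeasurable (by fun_prop),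
    complexLevyLambda_mul_I hν, mul_neg, ← neg_mul, ← hX.charFun_eq t s]
  refine integral_congr_ae (ae_of_all _ fun ω => ?_)
  simp only
  congr 1
  ring

theorem IsLevyProcessWithTriplet.integrable_exp [IsProbabilityMeasure P]
    (hX : IsLevyProcessWithTriplet X P ν σsq b) (hν : ∀ᵐ x ∂ν, |x| ≤ 1) (t : I) (v : ℝ) :
    Integrable (fun ω => Real.exp (v * X t ω)) P := by
  have hm := hX.isLevyProcess.measurable t
  have := Measure.isProbabilityMeasure_map (μ := P) hm.aemeasurable
  exact (integrable_map_measure (f := X t) (g := fun x => Real.exp (v * x)) (by fun_prop)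
    hm.aemeasurable).1 (integrable_exp_of_charFun_eq (G := fun z =>
      Complex.exp ((t : ℝ) * complexLevyLambda ν σsq b z))
      (((differentiable_complexLevyLambda hX.isLevyMeasure hν σsq b).const_mul _).cexp)
      (hX.charFun_map hν t) v)

theorem IsLevyProcessWithTriplet.integral_cexp [IsProbabilityMeasure P]
    (hX : IsLevyProcessWithTriplet X P ν σsq b) (hν : ∀ᵐ x ∂ν, |x| ≤ 1) (t : I) (z : ℂ) :
    ∫ ω, Complex.exp (z * X t ω) ∂P =
      Complex.exp ((t : ℝ) * complexLevyLambda ν σsq b z) := by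
  have hm := hX.isLevyProcess.measurable t
  have := Measure.isProbabilityMeasure_map (μ := P) hm.aemeasurable
  rw [← congr_fun (complexMGF_eq_of_charFun_eq (G := fun z =>
      Complex.exp ((t : ℝ) * complexLevyLambda ν σsq b z))
      (((differentiable_complexLevyLambda hX.isLevyMeasure hν σsq b).const_mul _).cexp)
      (hX.charFun_map hν t)) z, complexMGF_id_map hm.aemeasurable, complexMGF]

theorem IsLevyProcessWithTriplet.integral_exp [IsProbabilityMeasure P]
    (hX : IsLevyProcessWithTriplet X P ν σsq b) (hν : ∀ᵐ x ∂ν, |x| ≤ 1) (t : I) (v : ℝ) :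
    ∫ ω, Real.exp (v * X t ω) ∂P = Real.exp (t * levyLambda ν σsq b v) := by
  have h := hX.integral_cexp hν t v
  rw [complexLevyLambda_ofReal] at h
  rw [← Complex.ofReal_inj, ← integral_complex_ofReal]
  push_cast
  exact h

end

/-! ### Densities of product form and the Esscher transform -/

theorem withDensity_map_univ {Ω E : Type*} [MeasurableSpace Ω] [MeasurableSpace E]
    {P : Measure Ω} {Y : Ω → E} {g : E → ℝ≥0∞} (hY : Measurable Y) (hg : Measurable g) :
    (P.map Y).withDensity g Set.univ = ∫⁻ ω, g (Y ω) ∂P := by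
  rw [withDensity_apply _ .univ, Measure.restrict_univ, lintegral_map hg hY]

section

variable {Ω ι E : Type*} [MeasurableSpace Ω] [Fintype ι] [MeasurableSpace E] {P : Measure Ω}
  {Y : ι → Ω → E} {g : ι → E → ℝ≥0∞}

theorem withDensity_prod_inter_preimage (hY : ∀ i, Measurable (Y i)) (hind : iIndepFun Y P)
    (hg : ∀ i, Measurable (g i)) {A : ι → Set E} (hA : ∀ i, MeasurableSet (A i)) :
    P.withDensity (fun ω => ∏ i, g i (Y i ω)) (⋂ i, Y i ⁻¹' A i) =
      ∏ i, (P.map (Y i)).withDensity (g i) (A i) := by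
  have hm : MeasurableSet (⋂ i, Y i ⁻¹' A i) := .iInter fun i => hY i (hA i)
  have hi : ∀ i, Measurable ((A i).indicator (g i)) := fun i => (hg i).indicator (hA i)
  rw [withDensity_apply _ hm, ← lintegral_indicator hm]
  have h1 : ∀ ω, (⋂ i, Y i ⁻¹' A i).indicator (fun ω => ∏ i, g i (Y i ω)) ω =
      ∏ i, (A i).indicator (g i) (Y i ω) := by
    intro ω
    by_cases hω : ω ∈ ⋂ i, Y i ⁻¹' A i
    · rw [Set.indicator_of_mem hω]
      exact Finset.prod_congr rfl fun i _ =>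
        (Set.indicator_of_mem (s := A i) (Set.mem_iInter.1 hω i) (g i)).symm
    · rw [Set.indicator_of_notMem hω]
      obtain ⟨i, hi⟩ := not_forall.1 (fun h => hω (Set.mem_iInter.2 h))
      exact (Finset.prod_eq_zero (Finset.mem_univ i)
        (Set.indicator_of_notMem (s := A i) hi (g i))).symm
  rw [lintegral_congr h1, lintegral_prod_eq_prod_lintegral_of_indepFun Finset.univ
    (fun i ω => (A i).indicator (g i) (Y i ω)) (hind.comp _ hi) (fun i => (hi i).comp (hY i))]
  refine Finset.prod_congr rfl fun i _ => ?_
  rw [withDensity_apply _ (hA i), ← lintegral_indicator (hA i), lintegral_map (hi i) (hY i)]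

theorem map_withDensity_prod (hY : ∀ i, Measurable (Y i)) (hind : iIndepFun Y P)
    (hg : ∀ i, Measurable (g i)) (h1 : ∀ i, ∫⁻ ω, g i (Y i ω) ∂P = 1) (i : ι) :
    (P.withDensity fun ω => ∏ i, g i (Y i ω)).map (Y i) = (P.map (Y i)).withDensity (g i) := by
  classical
  ext A hA
  have h := withDensity_prod_inter_preimage hY hind hg (A := fun j => if j = i then A else Set.univ)
    (fun j => by split_ifs <;> simp [hA])
  rw [Finset.prod_eq_single i
    (fun j _ hj => by simp [hj, withDensity_map_univ (hY j) (hg j), h1 j]) (by simp)] at h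
  simp only [if_true] at h
  rw [Measure.map_apply (hY i) hA, ← h]
  congr 1
  ext ω
  simp only [Set.mem_preimage, Set.mem_iInter]
  refine ⟨fun h j => ?_, fun h => by simpa using h i⟩
  split_ifs with hj
  · exact hj ▸ h
  · trivial

/-- Independence is preserved by a change of measure whose density is a product of functions of
the individual variables. -/
theorem iIndepFun_withDensity_prod (hY : ∀ i, Measurable (Y i)) (hind : iIndepFun Y P)
    (hg : ∀ i, Measurable (g i)) (h1 : ∀ i, ∫⁻ ω, g i (Y i ω) ∂P = 1) :
    iIndepFun Y (P.withDensity fun ω => ∏ i, g i (Y i ω)) := by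
  classical
  rw [iIndepFun_iff_measure_inter_preimage_eq_mul]
  intro S A hA
  have h := withDensity_prod_inter_preimage hY hind hg
    (A := fun j => if j ∈ S then A j else Set.univ) (fun j => by split_ifs with hj <;> simp [hA, hj])
  rw [← Finset.prod_subset (Finset.subset_univ S)
    (fun j _ hj => by simp [hj, withDensity_map_univ (hY j) (hg j), h1 j])] at h
  have hset : (⋂ j, Y j ⁻¹' (if j ∈ S then A j else Set.univ)) = ⋂ j ∈ S, Y j ⁻¹' A j := by
    ext ω
    simp only [Set.mem_preimage, Set.mem_iInter]
    refine forall_congr' fun j => ?_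
    split_ifs with hj <;> simp [hj]
  rw [← hset, h]
  refine Finset.prod_congr rfl fun i hi => ?_
  rw [if_pos hi, ← map_withDensity_prod hY hind hg h1, Measure.map_apply (hY i) (hA i hi)]

end

theorem tendstoInMeasure_withDensity {α ι E : Type*} [MeasurableSpace α] [EDist E]
    {μ : Measure α} [SFinite μ] {D : α → ℝ≥0∞} (hD : ∫⁻ x, D x ∂μ ≠ ∞) {f : ι → α → E}
    {l : Filter ι} {g : α → E} (h : TendstoInMeasure μ f l g) :
    TendstoInMeasure (μ.withDensity D) f l g := by
  intro ε hε
  simp_rw [withDensity_apply']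
  exact tendsto_setLIntegral_zero hD (h ε hε)

section

variable {Ω : Type*} [MeasurableSpace Ω] {P : Measure Ω} {X : I → Ω → ℝ} {ν : Measure ℝ}
  {σsq : ℝ≥0} {b : ℝ}

/-- The density `e^{uy - lΛ(u)}` by which the law of an increment over a time span `l` is
tilted. -/
noncomputable def incrementDensity (ν : Measure ℝ) (σsq : ℝ≥0) (b u l y : ℝ) : ℝ≥0∞ :=
  ENNReal.ofReal (Real.exp (u * y - l * levyLambda ν σsq b u))

theorem measurable_incrementDensity (u l : ℝ) : Measurable (incrementDensity ν σsq b u l) := by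
  unfold incrementDensity
  fun_prop

theorem IsLevyProcessWithTriplet.lintegral_incrementDensity [IsProbabilityMeasure P]
    (hX : IsLevyProcessWithTriplet X P ν σsq b) (hν : ∀ᵐ x ∂ν, |x| ≤ 1) (u : ℝ) {s t : I}
    (hst : s ≤ t) :
    ∫⁻ ω, incrementDensity ν σsq b u (t - s) (X t ω - X s ω) ∂P = 1 := by
  have hst' : (s : ℝ) ≤ t := hst
  -- By stationarity the increment has the law of `X_{t-s} - X_0`.
  set r : I := ⟨t - s, sub_nonneg.2 hst', by linarith [s.2.1, t.2.2]⟩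
  have hid := (hX.isLevyProcess.stationaryIncrements s t 0 r hst r.2.1 (by simp [r])).comp
    (measurable_incrementDensity (ν := ν) (σsq := σsq) (b := b) u (t - s))
  have hlin := hid.lintegral_eq
  simp only [Function.comp_apply] at hlin
  rw [hlin]
  have hz : (fun ω => incrementDensity ν σsq b u (t - s) (X r ω - X 0 ω)) =ᵐ[P]
      fun ω => ENNReal.ofReal (Real.exp (u * X r ω) *
        Real.exp (-((t - s) * levyLambda ν σsq b u))) := by
    filter_upwards [hX.isLevyProcess.zero] with ω hω
    rw [incrementDensity, hω, sub_zero, ← Real.exp_add, sub_eq_add_neg]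
  rw [lintegral_congr_ae hz, ← ofReal_integral_eq_lintegral_ofReal
    ((hX.integrable_exp hν r u).mul_const _) (ae_of_all _ fun ω => by positivity),
    integral_mul_const, hX.integral_exp hν r u, ← Real.exp_add]
  simp [r]

/-- Along a partition `0 = τ₀ ≤ ⋯ ≤ τₘ = 1` the Esscher density factorizes over the increments. -/
theorem IsLevyProcessWithTriplet.esscherTransform_eq_prod
    (hX : IsLevyProcessWithTriplet X P ν σsq b) (u : ℝ) {τ : ℕ → I} {m : ℕ} (h0 : τ 0 = 0)
    (hm : τ m = 1) :
    esscherTransform X P ν σsq b u = P.withDensity fun ω => ∏ i : Fin m,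
      incrementDensity ν σsq b u (τ (i + 1) - τ i) (X (τ (i + 1)) ω - X (τ i) ω) := by
  refine withDensity_congr_ae ?_
  filter_upwards [hX.isLevyProcess.zero] with ω hω
  unfold incrementDensity
  rw [← ENNReal.ofReal_prod_of_nonneg (fun i _ => (Real.exp_pos _).le), ← Real.exp_sum,
    Fin.sum_univ_eq_sum_range (fun i : ℕ => u * (X (τ (i + 1)) ω - X (τ i) ω) -
      ((τ (i + 1) : ℝ) - τ i) * levyLambda ν σsq b u) m, Finset.sum_sub_distrib,
    ← Finset.mul_sum, ← Finset.sum_mul, Finset.sum_range_sub (fun i => X (τ i) ω),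
    Finset.sum_range_sub (fun i => (τ i : ℝ)), h0, hm, hω]
  simp

theorem IsLevyProcessWithTriplet.iIndepFun_esscherTransform [IsProbabilityMeasure P]
    (hX : IsLevyProcessWithTriplet X P ν σsq b) (hν : ∀ᵐ x ∂ν, |x| ≤ 1) (u : ℝ) {τ : ℕ → I}
    (hτ : Monotone τ) {m : ℕ} (h0 : τ 0 = 0) (hm : τ m = 1) :
    iIndepFun (fun (i : Fin m) ω => X (τ (i + 1)) ω - X (τ i) ω)
      (esscherTransform X P ν σsq b u) := by
  rw [hX.esscherTransform_eq_prod u h0 hm]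
  exact iIndepFun_withDensity_prod
    (fun i => (hX.isLevyProcess.measurable _).sub (hX.isLevyProcess.measurable _))
    ((hX.isLevyProcess.indepIncrements.nat hτ).precomp Fin.val_injective)
    (fun i => measurable_incrementDensity u _)
    (fun i => hX.lintegral_incrementDensity hν u (hτ (Nat.le_succ _)))

/-- Under the Esscher transform the law of `X_t - X_s` is the exponential tilt of its law
under `P`. -/
theorem IsLevyProcessWithTriplet.map_esscherTransform [IsProbabilityMeasure P]
    (hX : IsLevyProcessWithTriplet X P ν σsq b) (hν : ∀ᵐ x ∂ν, |x| ≤ 1) (u : ℝ) {s t : I}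
    (hst : s ≤ t) :
    (esscherTransform X P ν σsq b u).map (fun ω => X t ω - X s ω) =
      (P.map fun ω => X t ω - X s ω).withDensity (incrementDensity ν σsq b u (t - s)) := by
  -- In the partition `0 ≤ s ≤ t ≤ 1` the increment in question is the one with index `1`.
  let τ : ℕ → I
    | 0 => 0
    | 1 => s
    | 2 => t
    | _ => 1
  have hτ : Monotone τ := monotone_nat_of_le_succ fun n => by
    match n with
    | 0 => exact s.2.1
    | 1 => exact hst
    | 2 => exact t.2.2
    | _ + 3 => exact le_rfl
  rw [hX.esscherTransform_eq_prod u (τ := τ) (m := 3) rfl rfl]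
  exact map_withDensity_prod (Y := fun (i : Fin 3) ω => X (τ (i + 1)) ω - X (τ i) ω)
    (g := fun i : Fin 3 => incrementDensity ν σsq b u (τ (i + 1) - τ i))
    (fun i => (hX.isLevyProcess.measurable _).sub (hX.isLevyProcess.measurable _))
    ((hX.isLevyProcess.indepIncrements.nat hτ).precomp Fin.val_injective)
    (fun i => measurable_incrementDensity u _)
    (fun i => hX.lintegral_incrementDensity hν u (hτ (Nat.le_succ _))) 1

theorem IsLevyProcessWithTriplet.lintegral_esscherDensity [IsProbabilityMeasure P]
    (hX : IsLevyProcessWithTriplet X P ν σsq b) (hν : ∀ᵐ x ∂ν, |x| ≤ 1) (u : ℝ) :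
    ∫⁻ ω, ENNReal.ofReal (Real.exp (u * X 1 ω - levyLambda ν σsq b u)) ∂P = 1 := by
  rw [← hX.lintegral_incrementDensity hν u (zero_le_one : (0 : I) ≤ 1)]
  refine lintegral_congr_ae ?_
  filter_upwards [hX.isLevyProcess.zero] with ω hω
  simp [incrementDensity, hω]

theorem IsLevyProcessWithTriplet.isProbabilityMeasure_esscherTransform [IsProbabilityMeasure P]
    (hX : IsLevyProcessWithTriplet X P ν σsq b) (hν : ∀ᵐ x ∂ν, |x| ≤ 1) (u : ℝ) :
    IsProbabilityMeasure (esscherTransform X P ν σsq b u) :=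
  ⟨by simpa [esscherTransform] using hX.lintegral_esscherDensity hν u⟩

theorem IsLevyProcessWithTriplet.isLevyProcess_esscherTransform [IsProbabilityMeasure P]
    (hX : IsLevyProcessWithTriplet X P ν σsq b) (hν : ∀ᵐ x ∂ν, |x| ≤ 1) (u : ℝ) :
    IsLevyProcess X (esscherTransform X P ν σsq b u) := by
  have hac : esscherTransform X P ν σsq b u ≪ P := withDensity_absolutelyContinuous _ _
  have hm := hX.isLevyProcess.measurable
  refine ⟨hm, hac.ae_le hX.isLevyProcess.zero, fun n t ht => ?_, fun s t s' t' hst hst' h => ?_,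
    fun t => tendstoInMeasure_withDensity (by simp [hX.lintegral_esscherDensity hν u])
      (hX.isLevyProcess.stochasticContinuity t), hac.ae_le hX.isLevyProcess.cadlag⟩
  -- For independence, the times `t₀ ≤ ⋯ ≤ tₙ` are extended to a partition of `[0, 1]` by adding
  -- both endpoints.
  · let τ : ℕ → I := fun k =>
      if k = 0 then 0 else if h : k - 1 < n + 1 then t ⟨k - 1, h⟩ else 1
    have hτ : Monotone τ := by
      refine monotone_nat_of_le_succ fun k => ?_
      simp only [τ, Nat.add_sub_cancel, Nat.succ_ne_zero, if_false]
      split_ifs with h1 h2 h2 h3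
      · exact (t _).2.1
      · exact zero_le_one
      · exact ht (by simp)
      · exact (t _).2.2
      · omega
      · exact le_rfl
    have hτt : ∀ k (hk : k < n + 1), τ (k + 1) = t ⟨k, hk⟩ := fun k hk => by
      simp [τ, Nat.lt_succ_iff.1 hk]
    have hind := (hX.iIndepFun_esscherTransform hν u hτ (m := n + 2) (by simp [τ])
      (by simp [τ])).precomp (g := fun i : Fin n => (i.succ.castSucc : Fin (n + 2)))
      ((Fin.castSucc_injective _).comp (Fin.succ_injective _))
    convert hind using 3 with i
    simp only [Fin.val_castSucc, Fin.val_succ, hτt _ (Nat.lt_succ_of_lt i.2),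
      hτt _ (Nat.succ_lt_succ i.2)]
    rfl
  · refine ⟨((hm t).sub (hm s)).aemeasurable, ((hm t').sub (hm s')).aemeasurable, ?_⟩
    rw [hX.map_esscherTransform hν u hst, hX.map_esscherTransform hν u hst',
      (hX.isLevyProcess.stationaryIncrements s t s' t' hst hst' h).map_eq, h]

end

/-! ### The law of the process under the Esscher transform -/

section

variable {Ω : Type*} [MeasurableSpace Ω] {P : Measure Ω} [IsProbabilityMeasure P]
  {X : I → Ω → ℝ} {ν : Measure ℝ} {σsq : ℝ≥0} {b : ℝ}

/-- `E_Q e^{ivX_t} = E_P e^{(u+iv)X_t} / e^{tΛ(u)}`. -/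
theorem IsLevyProcessWithTriplet.integral_cexp_esscherTransform
    (hX : IsLevyProcessWithTriplet X P ν σsq b) (hν : ∀ᵐ x ∂ν, |x| ≤ 1) (u : ℝ) (t : I) (v : ℝ) :
    ∫ ω, Complex.exp (Complex.I * v * X t ω) ∂esscherTransform X P ν σsq b u =
      Complex.exp ((t : ℝ) * (complexLevyLambda ν σsq b (u + v * Complex.I) -
        complexLevyLambda ν σsq b u)) := by
  have hm := hX.isLevyProcess.measurable
  have hdiff : Measurable fun ω => X t ω - X 0 ω := (hm t).sub (hm 0)
  have hac : esscherTransform X P ν σsq b u ≪ P := withDensity_absolutelyContinuous _ _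
  have h0 : ∫ ω, Complex.exp (Complex.I * v * X t ω) ∂esscherTransform X P ν σsq b u =
      ∫ ω, Complex.exp (Complex.I * v * (X t ω - X 0 ω : ℝ)) ∂esscherTransform X P ν σsq b u := by
    refine integral_congr_ae ?_
    filter_upwards [hac.ae_le hX.isLevyProcess.zero] with ω hω
    rw [hω, sub_zero]
  have hmeas : Measurable fun y : ℝ => (incrementDensity ν σsq b u ((t : ℝ) - (0 : I)) y).toReal •
      Complex.exp (Complex.I * v * y) :=
    (measurable_incrementDensity u _).ennreal_toReal.smul (by fun_prop)
  rw [h0, ← integral_map (f := fun y : ℝ => Complex.exp (Complex.I * v * y)) hdiff.aemeasurable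
    (by fun_prop), hX.map_esscherTransform hν u t.2.1,
    integral_withDensity_eq_integral_toReal_smul (measurable_incrementDensity _ _)
    (by simp [incrementDensity]), integral_map hdiff.aemeasurable
    hmeas.aestronglyMeasurable, mul_sub, sub_eq_add_neg (((t : ℝ) : ℂ) * _), Complex.exp_add,
    ← hX.integral_cexp hν t, ← integral_mul_const]
  refine integral_congr_ae ?_
  filter_upwards [hX.isLevyProcess.zero] with ω hω
  simp only [incrementDensity, hω, sub_zero, ENNReal.toReal_ofReal (Real.exp_pos _).le,
    Complex.real_smul, Complex.ofReal_exp, complexLevyLambda_ofReal, ← Complex.exp_add]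
  congr 1
  push_cast [Set.Icc.coe_zero]
  ring

theorem lintegral_min_abs_sq_expTilt_lt_top (hL : IsLevyMeasure ν) (hν : ∀ᵐ x ∂ν, |x| ≤ 1)
    (u : ℝ) : ∫⁻ x, ENNReal.ofReal (min |x| (x ^ 2)) ∂expTilt ν u < ∞ := by
  rw [expTilt, lintegral_withDensity_eq_lintegral_mul _ (by fun_prop) (by fun_prop)]
  refine lt_of_le_of_lt (lintegral_mono_ae ?_)
    ((hL.integrable_sq hν).const_mul (Real.exp |u|)).lintegral_lt_top
  filter_upwards [hν] with x hx
  rw [Pi.mul_apply, ← ENNReal.ofReal_mul (Real.exp_pos _).le]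
  have h1 : u * x ≤ |u| := (le_abs_self _).trans
    (by rw [abs_mul]; exact mul_le_of_le_one_right (abs_nonneg _) hx)
  gcongr
  exact min_le_right _ _

theorem IsLevyProcessWithTriplet.isLevyMartingale_esscherTransform
    (hX : IsLevyProcessWithTriplet X P ν σsq b) (hν : ∀ᵐ x ∂ν, |x| ≤ 1) {u : ℝ}
    (hu : HasDerivAt (levyLambda ν σsq b) 0 u) :
    IsLevyMartingale X (esscherTransform X P ν σsq b u) (expTilt ν u) σsq where
  isLevyProcess := hX.isLevyProcess_esscherTransform hν u
  zero := withDensity_absolutelyContinuous _ _ hX.isLevyMeasure.zero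
  lintegral_lt_top := lintegral_min_abs_sq_expTilt_lt_top hX.isLevyMeasure hν u
  charFun_eq t v := by
    rw [hX.integral_cexp_esscherTransform hν,
      complexLevyLambda_add_mul_I_sub hX.isLevyMeasure hν hu, mul_neg, neg_mul]

end

/-! ### Comparison of the two measures on small balls -/

theorem abs_le_of_pathSupNorm_le {Ω : Type*} {X : I → Ω → ℝ} {ω : Ω} {ε : ℝ} (hε : 0 ≤ ε)
    (h : pathSupNorm X ω ≤ ENNReal.ofReal ε) (t : I) : |X t ω| ≤ ε :=
  (ENNReal.ofReal_le_ofReal_iff hε).1 ((le_iSup _ t).trans h)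

/-- If `|X₁| ≤ ε` on `A`, then the density of the Esscher transform lies between
`e^{-ε|u| - Λ(u)}` and `e^{ε|u| - Λ(u)}` on `A`. The set `A` need not be measurable; the
almost everywhere bound on it comes from the measurable set `{|X₁| ≤ ε}` containing it. -/
theorem esscherTransform_real_bounds {Ω : Type*} [MeasurableSpace Ω] {P : Measure Ω}
    [IsProbabilityMeasure P] {X : I → Ω → ℝ} {ν : Measure ℝ} {σsq : ℝ≥0} {b u ε : ℝ}
    (hX1 : Measurable (X 1)) {A : Set Ω} (hA : ∀ ω ∈ A, |X 1 ω| ≤ ε) :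
    Real.exp (levyLambda ν σsq b u - ε * |u|) * (esscherTransform X P ν σsq b u).real A ≤
        P.real A ∧
      P.real A ≤
        Real.exp (levyLambda ν σsq b u + ε * |u|) * (esscherTransform X P ν σsq b u).real A := by
  set L := levyLambda ν σsq b u
  have hB : MeasurableSet {ω | |X 1 ω| ≤ ε} := measurableSet_le hX1.abs measurable_const
  have hae : ∀ᵐ ω ∂P.restrict A, |u * X 1 ω| ≤ ε * |u| := by
    have : ∀ᵐ ω ∂P.restrict A, |X 1 ω| ≤ ε :=
      ae_mono (Measure.restrict_mono hA le_rfl) (ae_restrict_mem hB)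
    filter_upwards [this] with ω hω
    rw [abs_mul, mul_comm]
    gcongr
  have hQ : esscherTransform X P ν σsq b u A =
      ∫⁻ ω in A, ENNReal.ofReal (Real.exp (u * X 1 ω - L)) ∂P := withDensity_apply' _ _
  have hup : esscherTransform X P ν σsq b u A ≤ ENNReal.ofReal (Real.exp (ε * |u| - L)) * P A := by
    rw [hQ, ← setLIntegral_const]
    refine lintegral_mono_ae ?_
    filter_upwards [hae] with ω hω
    exact ENNReal.ofReal_le_ofReal (Real.exp_le_exp.2 (by linarith [(abs_le.1 hω).2]))
  have hlow : ENNReal.ofReal (Real.exp (-(ε * |u|) - L)) * P A ≤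
      esscherTransform X P ν σsq b u A := by
    rw [hQ, ← setLIntegral_const]
    refine lintegral_mono_ae ?_
    filter_upwards [hae] with ω hω
    exact ENNReal.ofReal_le_ofReal (Real.exp_le_exp.2 (by linarith [(abs_le.1 hω).1]))
  have hQtop : esscherTransform X P ν σsq b u A ≠ ∞ :=
    (hup.trans_lt (ENNReal.mul_lt_top ENNReal.ofReal_lt_top (measure_lt_top P A))).ne
  have hup' := ENNReal.toReal_mono (ENNReal.mul_ne_top ENNReal.ofReal_ne_top
    (measure_ne_top P A)) hup
  have hlow' := ENNReal.toReal_mono hQtop hlow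
  rw [ENNReal.toReal_mul, ENNReal.toReal_ofReal (Real.exp_pos _).le] at hup' hlow'
  constructor
  · calc _ ≤ Real.exp (L - ε * |u|) * (Real.exp (ε * |u| - L) * P.real A) := by
          gcongr
          exact hup'
      _ = P.real A := by
          rw [← mul_assoc, ← Real.exp_add, sub_add_sub_cancel, sub_self, Real.exp_zero, one_mul]
  · calc P.real A = Real.exp (L + ε * |u|) * (Real.exp (-(ε * |u|) - L) * P.real A) := by
          rw [← mul_assoc, ← Real.exp_add, ← neg_add', add_comm (ε * |u|), add_neg_cancel,
            Real.exp_zero, one_mul]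
      _ ≤ _ := by
          gcongr
          exact hlow'

theorem proposition1p3 {Ω : Type*} [MeasurableSpace Ω] (P : Measure Ω) [IsProbabilityMeasure P]
    (X : I → Ω → ℝ) (ν : Measure ℝ) (σsq : ℝ≥0) (b : ℝ)
    (hX : IsLevyProcessWithTriplet X P ν σsq b)
    (hν : ν.support ⊆ {x : ℝ | |x| ≤ 1})
    (u : ℝ) (hu : HasDerivAt (levyLambda ν σsq b) 0 u) :
    -- `Λ` is the (everywhere finite) logarithmic moment generating function of `X_1`
    (∀ v : ℝ, Integrable (fun ω => Real.exp (v * X 1 ω)) P ∧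
      Real.log (∫ ω, Real.exp (v * X 1 ω) ∂P) = levyLambda ν σsq b v) ∧
    IsProbabilityMeasure (esscherTransform X P ν σsq b u) ∧
    (∀ ε : ℝ, 0 < ε →
      Real.exp (levyLambda ν σsq b u - ε * |u|) *
          (esscherTransform X P ν σsq b u).real {ω | pathSupNorm X ω ≤ ENNReal.ofReal ε} ≤
        P.real {ω | pathSupNorm X ω ≤ ENNReal.ofReal ε} ∧
      P.real {ω | pathSupNorm X ω ≤ ENNReal.ofReal ε} ≤
        Real.exp (levyLambda ν σsq b u + ε * |u|) *
          (esscherTransform X P ν σsq b u).real {ω | pathSupNorm X ω ≤ ENNReal.ofReal ε}) ∧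
    IsLevyMartingale X (esscherTransform X P ν σsq b u) (expTilt ν u) σsq := by

  have hν' := ae_abs_le_one_of_support_subset hν
  refine ⟨fun v => ⟨hX.integrable_exp hν' 1 v, ?_⟩, hX.isProbabilityMeasure_esscherTransform hν' u,
    fun ε hε => esscherTransform_real_bounds (hX.isLevyProcess.measurable 1)
      fun ω hω => abs_le_of_pathSupNorm_le hε.le hω 1,
    hX.isLevyMartingale_esscherTransform hν' hu⟩
  rw [hX.integral_exp hν' 1 v, Real.log_exp]
  simp
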